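/- Corollary (right intervals of the Tamari lattice). For $n\ge 0$ let $\mathrm{Tam}_n$ be the classical Tamari lattice, i.e. the set of binary trees with $n$ internal nodes, ordered by the reflexive transitive closure of right rotation (replacing a subtree $((a,b),c)$ by $(a,(b,c))$), and let $\hat 1$ be its maximum. A right interval is an interval of the form $[x,\hat 1]$ with $x\in\mathrm{Tam}_n$, regarded as a poset with the induced order. For an element $a$ of a finite lattice $L$, a join representation of $a$ is a set of join-irreducible elements of $L$ whose join is $a$; the canonical join representation of $a$ is the antichain $A$ among the join representations of $a$ that refines every join representation $B$ of $a$ (for every $x\in A$ there is $y\in B$ with $x\le y$). The canonical join complex of $L$ consists of all canonical join representations of elements of $L$. For every right interval $I$ of $\mathrm{Tam}_n$, the canonical join complex of $I$ is a simplicial complex, it is vertex decomposable, and hence it is shellable (both in the sense of Björner and Wachs for not necessarily pure complexes). -/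

import Mathlib

/-! ## The Tamari lattice on binary trees -/

/-- `TamariRotation s t`: the binary tree `t` arises from `s` by one right rotation, i.e. by
replacing some subtree of the form `((a, b), c)` by `(a, (b, c))`. -/
inductive TamariRotation : BinaryTree Unit → BinaryTree Unit → Prop
  | rotate (a b c : BinaryTree Unit) :
      TamariRotation (.node () (.node () a b) c) (.node () a (.node () b c))
  | left {a a' : BinaryTree Unit} (b : BinaryTree Unit) (h : TamariRotation a a') :
      TamariRotation (.node () a b) (.node () a' b)
  | right (a : BinaryTree Unit) {b b' : BinaryTree Unit} (h : TamariRotation b b') :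
      TamariRotation (.node () a b) (.node () a b')

/-- The underlying set of the classical Tamari lattice: binary trees with `n` internal nodes. -/
def Tamari (n : ℕ) : Type := {t : BinaryTree Unit // t.numNodes = n}

theorem TamariRotation.numNodes_eq {s t : BinaryTree Unit} (h : TamariRotation s t) :
    s.numNodes = t.numNodes := by
  induction h with
  | rotate a b c => simp; omega
  | left b _ ih => simp [ih]
  | right a _ ih => simp [ih]

/-- Auxiliary statistic (sum of the sizes of all right subtrees): it shows that the reflexive
transitive closure of right rotation is antisymmetric. -/
def tamariRank : BinaryTree Unit → ℕ
  | .nil => 0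
  | .node _ a b => tamariRank a + tamariRank b + b.numNodes

theorem TamariRotation.tamariRank_lt {s t : BinaryTree Unit} (h : TamariRotation s t) :
    tamariRank s < tamariRank t := by
  induction h with
  | rotate a b c => simp [tamariRank]; omega
  | left b _ ih => simp only [tamariRank]; omega
  | right a h ih => have := h.numNodes_eq; simp only [tamariRank]; omega

theorem tamariRank_le {s t : BinaryTree Unit} (h : Relation.ReflTransGen TamariRotation s t) :
    s = t ∨ tamariRank s < tamariRank t := by
  induction h with
  | refl => exact Or.inl rfl
  | tail _ h ih =>
    right
    rcases ih with rfl | ih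
    · exact h.tamariRank_lt
    · exact ih.trans h.tamariRank_lt

/-- The Tamari order: `s ≤ t` if `t` arises from `s` by a finite sequence of right rotations. -/
instance (n : ℕ) : PartialOrder (Tamari n) where
  le s t := Relation.ReflTransGen TamariRotation s.1 t.1
  le_refl _ := Relation.ReflTransGen.refl
  le_trans _ _ _ := Relation.ReflTransGen.trans
  le_antisymm s t h₁ h₂ := by
    rcases tamariRank_le h₁ with h | h
    · exact Subtype.ext h
    · rcases tamariRank_le h₂ with h' | h'
      · exact Subtype.ext h'.symm
      · omega

/-- The right comb with `n` internal nodes. -/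
def rightComb : ℕ → BinaryTree Unit
  | 0 => .nil
  | n + 1 => .node () .nil (rightComb n)

theorem numNodes_rightComb (n : ℕ) : (rightComb n).numNodes = n := by
  induction n with
  | zero => rfl
  | succ n ih => simp [rightComb, ih]

theorem TamariRotation.reflTransGen_left {a a' : BinaryTree Unit} (b : BinaryTree Unit)
    (h : Relation.ReflTransGen TamariRotation a a') :
    Relation.ReflTransGen TamariRotation (.node () a b) (.node () a' b) :=
  h.lift (fun x => BinaryTree.node () x b) fun _ _ h => .left b h

theorem TamariRotation.reflTransGen_right (a : BinaryTree Unit) {b b' : BinaryTree Unit}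
    (h : Relation.ReflTransGen TamariRotation b b') :
    Relation.ReflTransGen TamariRotation (.node () a b) (.node () a b') :=
  h.lift (fun x => BinaryTree.node () a x) fun _ _ h => .right a h

theorem TamariRotation.reflTransGen_combs (m k : ℕ) :
    Relation.ReflTransGen TamariRotation
      (.node () (rightComb m) (rightComb k)) (rightComb (m + k + 1)) := by
  induction m with
  | zero => rw [Nat.zero_add]; exact Relation.ReflTransGen.refl
  | succ m ih =>
    have h := Relation.ReflTransGen.head
      (TamariRotation.rotate .nil (rightComb m) (rightComb k)) (TamariRotation.reflTransGen_right .nil ih)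
    have e : m + 1 + k + 1 = (m + k + 1) + 1 := by omega
    rw [e]
    exact h

theorem TamariRotation.reflTransGen_rightComb (t : BinaryTree Unit) :
    Relation.ReflTransGen TamariRotation t (rightComb t.numNodes) := by
  induction t with
  | nil => exact Relation.ReflTransGen.refl
  | node _ a b iha ihb =>
    exact ((TamariRotation.reflTransGen_left b iha).trans
      (TamariRotation.reflTransGen_right _ ihb)).trans
      (TamariRotation.reflTransGen_combs _ _)

/-- The maximum of the Tamari lattice is the right comb. -/
instance (n : ℕ) : OrderTop (Tamari n) where
  top := ⟨rightComb n, numNodes_rightComb n⟩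
  le_top t := by
    have h := TamariRotation.reflTransGen_rightComb t.1
    rw [t.2] at h
    exact h

/-- A right interval of a poset with a maximum: an interval `[x, ⊤]`. -/
def IsRightInterval {L : Type*} [PartialOrder L] [OrderTop L] (I : Set L) : Prop :=
  ∃ x : L, I = Set.Icc x ⊤

/-! ## Canonical join representations -/

/-- An element is join-irreducible if it covers exactly one element. -/
def IsJoinIrreducible {L : Type*} [PartialOrder L] (j : L) : Prop :=
  ∃! i : L, i ⋖ j

/-- `A` is a join representation of `a`: a set of join-irreducible elements whose join is `a`. -/
def IsJoinRepresentation {L : Type*} [PartialOrder L] (A : Finset L) (a : L) : Prop :=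
  (∀ j ∈ A, IsJoinIrreducible j) ∧ IsLUB (A : Set L) a

/-- `A` refines `B` if every element of `A` lies below some element of `B`. -/
def JoinRefines {L : Type*} [PartialOrder L] (A B : Finset L) : Prop :=
  ∀ x ∈ A, ∃ y ∈ B, x ≤ y

/-- `A` is the canonical join representation of `a`: the minimum, with respect to refinement,
of the join representations of `a`. Refinement is only a preorder on arbitrary finite sets and is
a partial order on antichains; as usual, the minimum is taken to be an antichain (equivalently, to
be irredundant), which determines it uniquely. -/
def IsCanonicalJoinRepresentation {L : Type*} [PartialOrder L] (A : Finset L) (a : L) : Prop :=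
  IsJoinRepresentation A a ∧ IsAntichain (· ≤ ·) (A : Set L) ∧
    ∀ B : Finset L, IsJoinRepresentation B a → JoinRefines A B

/-- The canonical join complex of `L`: its faces are the canonical join representations of the
elements of `L`. -/
def canonicalJoinComplex (L : Type*) [PartialOrder L] : Set (Finset L) :=
  {A | ∃ a : L, IsCanonicalJoinRepresentation A a}

/-! ## Simplicial complexes, given by their sets of faces (including the empty face) -/

/-- A simplicial complex: a family of finite sets that is closed under taking subsets. -/
def IsSimplicialComplex {V : Type*} (Δ : Set (Finset V)) : Prop :=
  ∀ σ ∈ Δ, ∀ τ : Finset V, τ ⊆ σ → τ ∈ Δ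

/-- A facet is a face that is maximal with respect to inclusion. -/
def IsFacet {V : Type*} (Δ : Set (Finset V)) (F : Finset V) : Prop :=
  F ∈ Δ ∧ ∀ G ∈ Δ, F ⊆ G → F = G

open Classical in
/-- The link of the vertex `v`. -/
def vertexLink {V : Type*} (Δ : Set (Finset V)) (v : V) : Set (Finset V) :=
  {G | G ∈ Δ ∧ v ∉ G ∧ insert v G ∈ Δ}

/-- The deletion of the vertex `v`. -/
def vertexDeletion {V : Type*} (Δ : Set (Finset V)) (v : V) : Set (Finset V) :=
  {G | G ∈ Δ ∧ v ∉ G}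

/-- Vertex decomposability of a (not necessarily pure) complex. The case `σ = ∅` of `simplex` is
the empty complex `{∅}`. -/
inductive VertexDecomposable {V : Type*} : Set (Finset V) → Prop
  | simplex (σ : Finset V) : VertexDecomposable {τ | τ ⊆ σ}
  | step (Δ : Set (Finset V)) (v : V) (hv : {v} ∈ Δ)
      (hlink : VertexDecomposable (vertexLink Δ v))
      (hdel : VertexDecomposable (vertexDeletion Δ v))
      (hshed : ∀ F : Finset V, IsFacet (vertexLink Δ v) F → ¬ IsFacet (vertexDeletion Δ v) F) :
      VertexDecomposable Δ

/-- Shellability of a (not necessarily pure) complex: its facets can be listed without repetition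
as `F 0, …, F (m - 1)` such that for each `j > 0` the intersection of (the simplex on) `F j` with
the complex generated by the earlier facets is pure of dimension `dim (F j) - 1`. -/
def Shellable {V : Type*} (Δ : Set (Finset V)) : Prop :=
  ∃ (m : ℕ) (F : Fin m → Finset V), Function.Injective F ∧ Set.range F = {G | IsFacet Δ G} ∧
    ∀ j : Fin m, 0 < j.val → ∀ G : Finset V,
      IsFacet {τ | τ ⊆ F j ∧ ∃ i : Fin m, i < j ∧ τ ⊆ F i} G → G.card + 1 = (F j).card

/-! ## Vertex decomposable complexes are shellable -/

section Simplicial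

variable {V : Type*}

/-! Assign to each node of a tree, numbered in inorder, the position of the last node of its right
subtree. This turns the Tamari order into the componentwise order on bracket vectors
(`Tamari.le_iff_bracketVector_le`), and `[x, ⊤]` into the set of all bracket vectors above that of
`x` (`Tamari.isBracketModel_Icc`).

In this model an arc `(i, j)`, where no bracket of `x` starting in `[i, j)` reaches `j`, yields a
join-irreducible: the least element whose entry at `i` is at least `j`. The canonical join
representation of an element is given by its descent arcs (`isCanonicalJoinRepresentation_image`),
and the sets of arcs that occur are exactly the pairwise compatible ones (`exists_descentArcs_eq`).
So the canonical join complex is a complex of noncrossing arcs.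

The set of arcs is closed under moving the left end to the right. This alone gives vertex
decomposability (`vertexDecomposable_noncrossingComplex`): among the arcs of length at least two,
one with maximal right end `j` and then minimal left end is shedding, because the short arc `(j - 1,
j)` can be added to every face of its link. Shellability follows by listing the facets of the
deletion before those through the shedding vertex. -/

open Classical in
theorem isSimplicialComplex_vertexLink {Δ : Set (Finset V)} (h : IsSimplicialComplex Δ) (v : V) :
    IsSimplicialComplex (vertexLink Δ v) := by
  rintro σ ⟨h₁, h₂, h₃⟩ τ hτ
  exact ⟨h σ h₁ τ hτ, fun hv => h₂ (hτ hv), h _ h₃ _ (Finset.insert_subset_insert v hτ)⟩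

theorem isSimplicialComplex_vertexDeletion {Δ : Set (Finset V)} (h : IsSimplicialComplex Δ)
    (v : V) : IsSimplicialComplex (vertexDeletion Δ v) := by
  rintro σ ⟨h₁, h₂⟩ τ hτ
  exact ⟨h σ h₁ τ hτ, fun hv => h₂ (hτ hv)⟩

/-- A facet of the deletion of a shedding vertex is a facet of the whole complex. -/
theorem IsFacet.of_vertexDeletion {Δ : Set (Finset V)} (hΔ : IsSimplicialComplex Δ) {v : V}
    (hshed : ∀ F : Finset V, IsFacet (vertexLink Δ v) F → ¬ IsFacet (vertexDeletion Δ v) F)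
    {F : Finset V} (hF : IsFacet (vertexDeletion Δ v) F) : IsFacet Δ F := by
  classical
  refine ⟨hF.1.1, fun G hG hFG => ?_⟩
  by_cases hv : v ∈ G
  · exfalso
    have h₁ : G.erase v ∈ vertexDeletion Δ v :=
      ⟨hΔ G hG _ (Finset.erase_subset v G), Finset.notMem_erase v G⟩
    have h₂ : F = G.erase v := hF.2 _ h₁ (Finset.subset_erase.2 ⟨hFG, hF.1.2⟩)
    refine hshed F ⟨⟨hF.1.1, hF.1.2, ?_⟩, fun H hH hFH => hF.2 H ⟨hH.1, hH.2.1⟩ hFH⟩ hF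
    rw [h₂]
    convert hG
    exact Finset.insert_erase hv
  · exact hF.2 G ⟨hG, hv⟩ hFG

open Classical in
theorem IsFacet.insert_of_vertexLink {Δ : Set (Finset V)} (hΔ : IsSimplicialComplex Δ) {v : V}
    {F : Finset V} (hF : IsFacet (vertexLink Δ v) F) : IsFacet Δ (insert v F) := by
  refine ⟨hF.1.2.2, fun G hG hFG => ?_⟩
  have hv : v ∈ G := hFG (Finset.mem_insert_self v F)
  have h := hF.2 (G.erase v)
    ⟨hΔ G hG _ (Finset.erase_subset v G), Finset.notMem_erase v G, by
      rwa [Finset.insert_erase hv]⟩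
    (Finset.subset_erase.2 ⟨(Finset.subset_insert v F).trans hFG, hF.1.2.1⟩)
  rw [h, Finset.insert_erase hv]

theorem IsFacet.vertexDeletion {Δ : Set (Finset V)} {v : V} {F : Finset V} (hF : IsFacet Δ F)
    (hv : v ∉ F) : IsFacet (vertexDeletion Δ v) F :=
  ⟨⟨hF.1, hv⟩, fun G hG h => hF.2 G hG.1 h⟩

open Classical in
theorem IsFacet.vertexLink_erase {Δ : Set (Finset V)} (hΔ : IsSimplicialComplex Δ) {v : V}
    {F : Finset V} (hF : IsFacet Δ F) (hv : v ∈ F) : IsFacet (vertexLink Δ v) (F.erase v) := by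
  refine ⟨⟨hΔ F hF.1 _ (Finset.erase_subset v F), Finset.notMem_erase v F, by
    rw [Finset.insert_erase hv]; exact hF.1⟩, fun G hG h => ?_⟩
  have := hF.2 (insert v G) hG.2.2 (by
    rw [← Finset.insert_erase hv]; exact Finset.insert_subset_insert v h)
  rw [this, Finset.erase_insert hG.2.1]

/-- `V` may be infinite, so maximal faces need not exist a priori. In the shelling this places each
facet of the link inside a facet of the deletion. -/
theorem VertexDecomposable.exists_facet {Δ : Set (Finset V)} (h : VertexDecomposable Δ) :
    IsSimplicialComplex Δ → ∀ τ ∈ Δ, ∃ F, IsFacet Δ F ∧ τ ⊆ F := by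
  classical
  induction h with
  | simplex σ => exact fun _ τ hτ => ⟨σ, ⟨Finset.Subset.refl σ, fun G hG h => h.antisymm hG⟩, hτ⟩
  | step Δ v hv _ _ hshed ihl ihd =>
    intro hΔ τ hτ
    by_cases h : v ∈ τ
    · obtain ⟨F, hF, hτF⟩ := ihl (isSimplicialComplex_vertexLink hΔ v) (τ.erase v)
        ⟨hΔ τ hτ _ (Finset.erase_subset v τ), Finset.notMem_erase v τ, by
          convert hτ; exact Finset.insert_erase h⟩
      refine ⟨insert v F, hF.insert_of_vertexLink hΔ, ?_⟩
      rw [← Finset.insert_erase h]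
      exact Finset.insert_subset_insert v hτF
    · obtain ⟨F, hF, hτF⟩ := ihd (isSimplicialComplex_vertexDeletion hΔ v) τ ⟨hτ, h⟩
      exact ⟨F, hF.of_vertexDeletion hΔ hshed, hτF⟩

/-- A list of finite sets is a shelling if, for each member but the first, the intersection with
the complex generated by the earlier members is pure of codimension one. -/
def IsShellingList (l : List (Finset V)) : Prop :=
  ∀ (j : ℕ) (hj : j < l.length), 0 < j → ∀ G : Finset V,
    IsFacet {τ | τ ⊆ l[j] ∧ ∃ (i : ℕ) (hi : i < j), τ ⊆ l[i]} G → G.card + 1 = l[j].card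

theorem IsShellingList.shellable {Δ : Set (Finset V)} {l : List (Finset V)}
    (hl : IsShellingList l) (hnd : l.Nodup) (hmem : ∀ F, F ∈ l ↔ IsFacet Δ F) :
    Shellable Δ := by
  refine ⟨l.length, l.get, List.nodup_iff_injective_get.1 hnd, ?_, fun j hj G hG => ?_⟩
  · ext F
    rw [Set.mem_range, Set.mem_ofPred_eq, ← hmem, List.mem_iff_get]
  · refine hl j j.2 hj G ?_
    have e : {τ | τ ⊆ l[(j : ℕ)] ∧ ∃ (i : ℕ) (hi : i < j), τ ⊆ l[i]} =
        {τ | τ ⊆ l.get j ∧ ∃ i : Fin l.length, i < j ∧ τ ⊆ l.get i} := by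
      ext τ
      refine and_congr Iff.rfl ⟨?_, ?_⟩
      · rintro ⟨i, hi, h⟩
        exact ⟨⟨i, hi.trans j.2⟩, hi, h⟩
      · rintro ⟨i, hi, h⟩
        exact ⟨i, hi, h⟩
    rwa [e]

open Classical in
theorem IsShellingList.append_map_insert {l₁ l₂ : List (Finset V)} {v : V}
    (h₁ : IsShellingList l₁) (h₂ : IsShellingList l₂)
    (hv₁ : ∀ F ∈ l₁, v ∉ F) (hv₂ : ∀ F ∈ l₂, v ∉ F) (hsub : ∀ F ∈ l₂, ∃ G ∈ l₁, F ⊆ G) :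
    IsShellingList (l₁ ++ l₂.map (insert v)) := by
  intro j hj hj0 G hG
  by_cases hjl : j < l₁.length
  · rw [List.getElem_append_left hjl]
    refine h₁ j hjl hj0 G ?_
    convert hG using 4 with τ
    · rw [List.getElem_append_left hjl]
    · refine exists_congr fun i => exists_congr fun hi => ?_
      rw [List.getElem_append_left (hi.trans hjl)]
  · push Not at hjl
    obtain ⟨k, rfl⟩ := Nat.exists_eq_add_of_le hjl
    have hk : k < l₂.length := by simpa using hj
    have key : ∀ (i : ℕ) (hi : i < l₂.length),
        (l₁ ++ l₂.map (insert v))[l₁.length + i]'(by simpa using hi) = insert v l₂[i] := by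
      intro i hi
      rw [List.getElem_append_right (by omega)]
      simp
    have hvk : v ∉ l₂[k] := hv₂ _ (List.getElem_mem hk)
    simp only [key k hk] at hG ⊢
    rw [Finset.card_insert_of_notMem hvk]
    obtain ⟨⟨hG₁, i, hi, hG₂⟩, hmax⟩ := hG
    -- Only earlier members of the second block contain `v`, so for `v ∈ G` erasing `v` reduces to
    -- the shelling `l₂`.
    by_cases hvG : v ∈ G
    · have hil : l₁.length ≤ i := by
        by_contra hil
        push Not at hil
        rw [List.getElem_append_left hil] at hG₂
        exact hv₁ _ (List.getElem_mem hil) (hG₂ hvG)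
      obtain ⟨i, rfl⟩ := Nat.exists_eq_add_of_le hil
      have hik : i < k := by omega
      rw [key i (hik.trans hk)] at hG₂
      have := h₂ k hk (by omega) (G.erase v) ⟨⟨?_, i, hik, ?_⟩, ?_⟩
      · rw [← this, Finset.card_erase_add_one hvG]
      · rwa [← Finset.subset_insert_iff]
      · rwa [← Finset.subset_insert_iff]
      · rintro H ⟨hH₁, m, hm, hH₂⟩ hGH
        have hGv : G = insert v H := hmax (insert v H)
          ⟨Finset.insert_subset_insert v hH₁, l₁.length + m, by omega, by
            rw [key m (hm.trans hk)]; exact Finset.insert_subset_insert v hH₂⟩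
          (by rwa [Finset.subset_insert_iff])
        rw [hGv, Finset.erase_insert fun h => hvk (hH₁ h)]
    -- Without `v`, `G` lies in `l₂[k]`, which is itself a face of the earlier complex and has
    -- codimension one.
    · obtain ⟨F, hF, hkF⟩ := hsub _ (List.getElem_mem hk)
      obtain ⟨m, hm, rfl⟩ := List.getElem_of_mem hF
      have : G = l₂[k] := hmax l₂[k]
        ⟨Finset.subset_insert _ _, m, by omega, by rwa [List.getElem_append_left hm]⟩
        ((Finset.subset_insert_iff_of_notMem hvG).1 hG₁)
      rw [this]

theorem VertexDecomposable.exists_shellingList {Δ : Set (Finset V)} (h : VertexDecomposable Δ) :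
    IsSimplicialComplex Δ →
      ∃ l : List (Finset V), l.Nodup ∧ (∀ F, F ∈ l ↔ IsFacet Δ F) ∧ IsShellingList l := by
  classical
  induction h with
  | simplex σ =>
    refine fun _ => ⟨[σ], List.nodup_singleton σ, fun F => ?_, fun j hj hj0 => ?_⟩
    · rw [List.mem_singleton]
      constructor
      · rintro rfl
        exact ⟨Finset.Subset.refl F, fun G hG h => h.antisymm hG⟩
      · exact fun hF => hF.2 σ (Finset.Subset.refl σ) hF.1
    · simp at hj
      omega
  | step Δ v hv _ hdel hshed ihl ihd =>
    intro hΔ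
    obtain ⟨l₁, hnd₁, hm₁, hs₁⟩ := ihd (isSimplicialComplex_vertexDeletion hΔ v)
    obtain ⟨l₂, hnd₂, hm₂, hs₂⟩ := ihl (isSimplicialComplex_vertexLink hΔ v)
    have hv₁ : ∀ F ∈ l₁, v ∉ F := fun F hF => ((hm₁ F).1 hF).1.2
    have hv₂ : ∀ F ∈ l₂, v ∉ F := fun F hF => ((hm₂ F).1 hF).1.2.1
    refine ⟨l₁ ++ l₂.map (insert v), ?_, fun F => ?_, hs₁.append_map_insert hs₂ hv₁ hv₂ ?_⟩
    · refine List.Nodup.append hnd₁ (hnd₂.map_on fun F hF G hG h => ?_) fun F hF hF' => ?_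
      · rw [← Finset.erase_insert (hv₂ F hF), h, Finset.erase_insert (hv₂ G hG)]
      · obtain ⟨G, -, rfl⟩ := List.mem_map.1 hF'
        exact hv₁ _ hF (Finset.mem_insert_self v G)
    · rw [List.mem_append, List.mem_map, hm₁]
      constructor
      · rintro (h | ⟨G, hG, rfl⟩)
        · exact h.of_vertexDeletion hΔ hshed
        · exact ((hm₂ G).1 hG).insert_of_vertexLink hΔ
      · intro hF
        by_cases h : v ∈ F
        · exact Or.inr ⟨F.erase v, (hm₂ _).2 (hF.vertexLink_erase hΔ h), Finset.insert_erase h⟩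
        · exact Or.inl (hF.vertexDeletion h)
    · intro F hF
      have hF' := ((hm₂ F).1 hF).1
      obtain ⟨G, hG, hFG⟩ := hdel.exists_facet (isSimplicialComplex_vertexDeletion hΔ v) F
        ⟨hF'.1, hF'.2.1⟩
      exact ⟨G, (hm₁ G).2 hG, hFG⟩

/-- A vertex decomposable complex is shellable. -/
theorem VertexDecomposable.shellable {Δ : Set (Finset V)} (h : VertexDecomposable Δ)
    (hΔ : IsSimplicialComplex Δ) : Shellable Δ := by
  obtain ⟨l, hnd, hm, hs⟩ := h.exists_shellingList hΔ
  exact hs.shellable hnd hm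

end Simplicial

/-! ## Complexes of noncrossing arcs -/

section Arcs

/-- Two arcs are compatible if their left endpoints differ, their right endpoints differ, and they
do not cross. -/
def ArcsCompatible (p q : ℕ × ℕ) : Prop :=
  p.1 ≠ q.1 ∧ p.2 ≠ q.2 ∧ ¬ (p.1 < q.1 ∧ q.1 < p.2 ∧ p.2 < q.2) ∧
    ¬ (q.1 < p.1 ∧ p.1 < q.2 ∧ q.2 < p.2)

theorem ArcsCompatible.symm {p q : ℕ × ℕ} (h : ArcsCompatible p q) : ArcsCompatible q p :=
  ⟨h.1.symm, h.2.1.symm, h.2.2.2, h.2.2.1⟩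

/-- The complex of sets of pairwise compatible elements of `W`, which are regarded as arcs by
means of the labelling `g`. -/
def noncrossingComplex {α : Type*} (g : α → ℕ × ℕ) (W : Finset α) : Set (Finset α) :=
  {σ | σ ⊆ W ∧ (σ : Set α).Pairwise fun a b => ArcsCompatible (g a) (g b)}

variable {α : Type*} {g : α → ℕ × ℕ}

theorem isSimplicialComplex_noncrossingComplex (W : Finset α) :
    IsSimplicialComplex (noncrossingComplex g W) :=
  fun _ hσ _ hτ => ⟨hτ.trans hσ.1, hσ.2.mono (Finset.coe_subset.2 hτ)⟩

theorem mem_noncrossingComplex_insert [DecidableEq α] {W σ : Finset α} {v : α}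
    (hσ : σ ∈ noncrossingComplex g W) (hv : v ∈ W)
    (h : ∀ a ∈ σ, a ≠ v → ArcsCompatible (g v) (g a)) :
    insert v σ ∈ noncrossingComplex g W := by
  refine ⟨Finset.insert_subset hv hσ.1, ?_⟩
  rw [Finset.coe_insert, Set.pairwise_insert]
  exact ⟨hσ.2, fun a ha hav => ⟨h a ha hav.symm, (h a ha hav.symm).symm⟩⟩

open Classical in
theorem vertexDeletion_noncrossingComplex (W : Finset α) (v : α) :
    vertexDeletion (noncrossingComplex g W) v = noncrossingComplex g (W.erase v) := by
  ext σ
  simp only [vertexDeletion, noncrossingComplex, Set.mem_ofPred_eq, Finset.subset_erase]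
  tauto

open Classical in
theorem vertexLink_noncrossingComplex {W : Finset α} {v : α} (hv : v ∈ W) :
    vertexLink (noncrossingComplex g W) v =
      noncrossingComplex g (W.filter fun a => ArcsCompatible (g v) (g a)) := by
  ext σ
  constructor
  · rintro ⟨h₁, h₂, h₃⟩
    refine ⟨fun a ha => Finset.mem_filter.2 ⟨h₁.1 ha, ?_⟩, h₁.2⟩
    exact h₃.2 (by simp) (by simp [ha]) (by rintro rfl; exact h₂ ha)
  · rintro ⟨h₁, h₂⟩
    have h₃ : σ ∈ noncrossingComplex g W := ⟨h₁.trans (Finset.filter_subset _ _), h₂⟩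
    refine ⟨h₃, fun h => (Finset.mem_filter.1 (h₁ h)).2.1 rfl, ?_⟩
    exact mem_noncrossingComplex_insert h₃ hv fun a ha _ => (Finset.mem_filter.1 (h₁ ha)).2

/-- If a set of arcs contains with an arc `(i, j)` all arcs `(k, j)`, `i < k < j`, then the complex
of its noncrossing subsets is vertex decomposable. -/
theorem vertexDecomposable_noncrossingComplex (W : Finset α) (hinj : Set.InjOn g W)
    (hlt : ∀ a ∈ W, (g a).1 < (g a).2)
    (hW : ∀ a ∈ W, ∀ k, (g a).1 < k → k < (g a).2 → ∃ b ∈ W, g b = (k, (g a).2)) :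
    VertexDecomposable (noncrossingComplex g W) := by
  classical
  induction hc : W.card using Nat.strong_induction_on generalizing W with
  | _ c ih =>
  by_cases hlong : (W.filter fun a => (g a).1 + 1 < (g a).2).Nonempty
  -- `u` fixes the largest right end of a long arc; `v` has this right end and the smallest possible
  -- left end.
  · obtain ⟨u, hu, humax⟩ := Finset.exists_max_image _ (fun a => (g a).2) hlong
    have hne : (W.filter fun a => (g a).2 = (g u).2).Nonempty :=
      ⟨u, Finset.mem_filter.2 ⟨(Finset.mem_filter.1 hu).1, rfl⟩⟩
    obtain ⟨v, hv, hvmin⟩ := Finset.exists_min_image _ (fun a => (g a).1) hne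
    rw [Finset.mem_filter] at hu hv
    obtain ⟨hvW, hvu⟩ := hv
    have hvlong : (g v).1 + 1 < (g v).2 := by
      have := hvmin u (Finset.mem_filter.2 ⟨hu.1, rfl⟩)
      omega
    have hmax : ∀ a ∈ W, (g a).1 + 1 < (g a).2 → (g a).2 ≤ (g v).2 := fun a ha h => by
      rw [hvu]; exact humax a (Finset.mem_filter.2 ⟨ha, h⟩)
    have hmin : ∀ a ∈ W, (g a).2 = (g v).2 → (g v).1 ≤ (g a).1 := fun a ha h =>
      hvmin a (Finset.mem_filter.2 ⟨ha, h.trans hvu⟩)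
    -- The arc `w = (j - 1, j)` has no integer strictly inside, so it conflicts only with arcs that
    -- share an end with it.
    obtain ⟨w, hwW, hw⟩ := hW v hvW ((g v).2 - 1) (by omega) (by omega)
    have hw₁ : (g w).1 = (g v).2 - 1 := by rw [hw]
    have hw₂ : (g w).2 = (g v).2 := by rw [hw]
    have hwc : ∀ a ∈ W, (g a).2 ≠ (g v).2 → ArcsCompatible (g w) (g a) := by
      intro a ha h
      have h₁ := hlt a ha
      have h₂ := hmax a ha
      refine ⟨fun h => ?_, fun h => ?_, fun h => ?_, fun h => ?_⟩ <;> omega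
    refine .step _ v ?_ ?_ ?_ ?_
    · exact ⟨by simpa using hvW, by simp⟩
    · rw [vertexLink_noncrossingComplex hvW]
      refine ih _ ?_ _ (hinj.mono (Finset.coe_subset.2 (Finset.filter_subset _ _)))
        (fun a ha => hlt a (Finset.mem_filter.1 ha).1) ?_ rfl
      · rw [← hc]
        refine Finset.card_lt_card (Finset.filter_ssubset.2 ⟨v, hvW, fun h => h.1 rfl⟩)
      · intro a ha k hk₁ hk₂
        rw [Finset.mem_filter] at ha
        obtain ⟨b, hb, hgb⟩ := hW a ha.1 k hk₁ hk₂
        refine ⟨b, Finset.mem_filter.2 ⟨hb, ?_⟩, hgb⟩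
        -- As `a` ends before `v` does, it lies wholly to the left of `v` or is nested inside it;
        -- moving its left end to the right preserves either case.
        have h₁ := hmax a ha.1 (by omega)
        obtain ⟨h₂, h₃, h₄, h₅⟩ := ha.2
        rw [hgb]
        refine ⟨fun h => ?_, fun h => ?_, fun h => ?_, fun h => ?_⟩ <;> simp only at h <;> omega
    · rw [vertexDeletion_noncrossingComplex]
      refine ih _ ?_ _ (hinj.mono (by simp)) (fun a ha => hlt a (Finset.mem_of_mem_erase ha)) ?_ rfl
      · rw [← hc]
        exact Finset.card_erase_lt_of_mem hvW
      · intro a ha k hk₁ hk₂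
        have haW := Finset.mem_of_mem_erase ha
        obtain ⟨b, hb, hgb⟩ := hW a haW k hk₁ hk₂
        refine ⟨b, Finset.mem_erase.2 ⟨?_, hb⟩, hgb⟩
        -- By minimality of its left end, `v` is never an arc that the closure hypothesis demands.
        rintro rfl
        have := hmin a haW (by rw [hgb])
        rw [hgb] at this
        simp only at this
        omega
    -- No arc of a link face ends where `v` does, so `w` extends the face within the deletion.
    · rintro F ⟨hF, -⟩ ⟨hF', hFmax⟩
      have hFv : ∀ a ∈ F, ArcsCompatible (g v) (g a) := by
        rw [vertexLink_noncrossingComplex hvW] at hF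
        exact fun a ha => (Finset.mem_filter.1 (hF.1 ha)).2
      have hwF : w ∉ F := fun h => (hFv w h).2.1 hw₂.symm
      have := hFmax (insert w F) ⟨mem_noncrossingComplex_insert hF.1 hwW fun a ha _ =>
        hwc a (hF.1.1 ha) fun h => (hFv a ha).2.1 h.symm, ?_⟩ (Finset.subset_insert w F)
      · exact hwF (this ▸ Finset.mem_insert_self w F)
      · rw [Finset.mem_insert]
        rintro (h | h)
        · rw [h] at hvlong; omega
        · exact hF.2.1 h
  -- All arcs now have length one; distinct ones are compatible and the complex is a simplex.
  · have h : noncrossingComplex g W = {τ | τ ⊆ W} := by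
      ext σ
      refine ⟨fun h => h.1, fun h => ⟨h, fun a ha b hb hab => ?_⟩⟩
      have hshort : ∀ a ∈ W, (g a).2 = (g a).1 + 1 := fun a ha => by
        have h₁ := hlt a ha
        have h₂ : ¬ (g a).1 + 1 < (g a).2 := fun h' => hlong ⟨a, Finset.mem_filter.2 ⟨ha, h'⟩⟩
        omega
      have h₁ := hshort a (h ha)
      have h₂ := hshort b (h hb)
      have h₃ : ¬ ((g a).1 = (g b).1 ∧ (g a).2 = (g b).2) := fun h' =>
        hab (hinj (h ha) (h hb) (Prod.ext h'.1 h'.2))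
      refine ⟨fun h => ?_, fun h => ?_, fun h => ?_, fun h => ?_⟩ <;> omega
    rw [h]
    exact .simplex W

end Arcs

/-! ### Entrywise comparison of lists -/

theorem List.Forall₂.of_append {α β : Type*} {R : α → β → Prop} {l₁ l₂ : List α}
    {m₁ m₂ : List β} (h : List.Forall₂ R (l₁ ++ l₂) (m₁ ++ m₂)) (hl : l₁.length = m₁.length) :
    List.Forall₂ R l₁ m₁ ∧ List.Forall₂ R l₂ m₂ := by
  have h₁ := List.forall₂_take_append _ _ _ h
  have h₂ := List.forall₂_drop_append _ _ _ h
  rw [← hl] at h₁ h₂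
  simpa using And.intro h₁ h₂

theorem List.Forall₂.le_trans {α : Type*} [Preorder α] {l₁ l₂ l₃ : List α}
    (h₁ : List.Forall₂ (· ≤ ·) l₁ l₂) (h₂ : List.Forall₂ (· ≤ ·) l₂ l₃) :
    List.Forall₂ (· ≤ ·) l₁ l₃ := by
  rw [List.forall₂_iff_get] at h₁ h₂ ⊢
  exact ⟨h₁.1.trans h₂.1, fun i hi hi' =>
    (h₁.2 i hi (h₁.1 ▸ hi)).trans (h₂.2 i (h₁.1 ▸ hi) hi')⟩

/-! ## Right subtree sizes of binary trees -/

section RightSizes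

/-- The sizes of the right subtrees of the nodes of a binary tree, in inorder. -/
def rightSizes : BinaryTree Unit → List ℕ
  | .nil => []
  | .node _ a b => rightSizes a ++ b.numNodes :: rightSizes b

theorem length_rightSizes (t : BinaryTree Unit) : (rightSizes t).length = t.numNodes := by
  induction t with
  | nil => rfl
  | node _ a b iha ihb => simp [rightSizes, iha, ihb]; omega

theorem add_getElem_rightSizes_lt (t : BinaryTree Unit) :
    ∀ (k : ℕ) (hk : k < (rightSizes t).length), k + (rightSizes t)[k] < t.numNodes := by
  induction t with
  | nil => exact fun k hk => by simp [rightSizes] at hk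
  | node _ a b iha ihb =>
    intro k hk
    simp only [rightSizes, BinaryTree.numNodes]
    have la := length_rightSizes a
    rcases lt_trichotomy k (rightSizes a).length with h | h | h
    · rw [List.getElem_append_left h]
      have := iha k h
      omega
    · subst h
      simp
      omega
    · obtain ⟨m, rfl⟩ := Nat.exists_eq_add_of_lt h
      rw [List.getElem_append_right (by omega)]
      have e : (rightSizes a).length + m + 1 - (rightSizes a).length = m + 1 := by omega
      have hm : m < (rightSizes b).length := by simp [rightSizes] at hk; omega
      simp only [e, List.getElem_cons_succ]
      have := ihb m hm
      omega

/-- A rotation enlarges the right subtree of a single node and leaves the inorder unchanged. -/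
theorem TamariRotation.forall₂_rightSizes {s t : BinaryTree Unit} (h : TamariRotation s t) :
    List.Forall₂ (· ≤ ·) (rightSizes s) (rightSizes t) := by
  induction h with
  | rotate a b c =>
    simp only [rightSizes, List.append_assoc, List.cons_append, BinaryTree.numNodes]
    refine List.rel_append (List.forall₂_refl _) (List.Forall₂.cons (by omega) ?_)
    exact List.forall₂_refl _
  | left b h ih => exact List.rel_append ih (List.forall₂_refl _)
  | right a h ih =>
    refine List.rel_append (List.forall₂_refl _) (List.Forall₂.cons ?_ ih)
    exact h.numNodes_eq.le

theorem forall₂_rightSizes_of_reflTransGen {s t : BinaryTree Unit}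
    (h : Relation.ReflTransGen TamariRotation s t) :
    List.Forall₂ (· ≤ ·) (rightSizes s) (rightSizes t) := by
  induction h with
  | refl => exact List.forall₂_refl _
  | tail _ h ih => exact ih.le_trans h.forall₂_rightSizes

/-- If the right subtree sizes of `s` are bounded by `u ++ w :: v`, where no entry of `u` reaches
beyond `u`, then right rotations bring the node in position `u.length` to the root. -/
theorem exists_rotation_to_root (s : BinaryTree Unit) :
    ∀ (u v : List ℕ) (w : ℕ), List.Forall₂ (· ≤ ·) (rightSizes s) (u ++ w :: v) →
      (∀ (k : ℕ) (hk : k < u.length), k + u[k] < u.length) →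
      ∃ a b, Relation.ReflTransGen TamariRotation s (.node () a b) ∧
        List.Forall₂ (· ≤ ·) (rightSizes a) u ∧ List.Forall₂ (· ≤ ·) (rightSizes b) v := by
  induction s with
  | nil =>
    intro u v w h
    have := h.length_eq
    simp [rightSizes] at this
  | node _ a b iha ihb =>
    intro u v w h hu
    have hlen := h.length_eq
    have la := length_rightSizes a
    have lb := length_rightSizes b
    simp only [rightSizes, List.length_append, List.length_cons] at hlen
    simp only [rightSizes] at h
    rcases lt_trichotomy (rightSizes a).length u.length with hau | hau | hau
    -- The right subtree of the root extends to the last node, whereas an entry of `u` may not reach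
    -- beyond `u`.
    · exfalso
      have hu' : u = u.take (rightSizes a).length ++
          u[(rightSizes a).length] :: u.drop ((rightSizes a).length + 1) := by
        simp
      rw [hu', List.append_assoc] at h
      have h' := (h.of_append (by simp; omega)).2
      rw [List.cons_append, List.forall₂_cons] at h'
      have := hu _ hau
      omega
    · obtain ⟨h₁, h₂⟩ := h.of_append hau
      exact ⟨a, b, .refl, h₁, (List.forall₂_cons.1 h₂).2⟩
    -- The wanted node lies in the left subtree: bring it to the root there, then rotate once more.
    · obtain ⟨q, hq⟩ := Nat.exists_eq_add_of_lt hau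
      have hv : u ++ w :: v = (u ++ w :: v.take q) ++ v.drop q := by simp
      rw [hv] at h
      obtain ⟨h₁, h₂⟩ := h.of_append (by simp; omega)
      obtain ⟨x, v₂, hx, h₃, h₄⟩ := List.forall₂_cons_left_iff.1 h₂
      obtain ⟨a₁, b₁, hr, ha₁, hb₁⟩ := iha _ _ _ h₁ hu
      refine ⟨a₁, .node () b₁ b,
        (TamariRotation.reflTransGen_left b hr).tail (.rotate a₁ b₁ b), ha₁, ?_⟩
      rw [← List.take_append_drop q v, h₄]
      exact List.rel_append hb₁ (List.Forall₂.cons hx h₃)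

/-- Rotate the node of `s` in the root position of `t` to the root; the bounds are inherited by both
subtrees. -/
theorem reflTransGen_of_forall₂_rightSizes (t : BinaryTree Unit) :
    ∀ s : BinaryTree Unit, List.Forall₂ (· ≤ ·) (rightSizes s) (rightSizes t) →
      Relation.ReflTransGen TamariRotation s t := by
  induction t with
  | nil =>
    intro s h
    have := h.length_eq
    rw [length_rightSizes, length_rightSizes] at this
    cases s with
    | nil => exact .refl
    | node _ a b => simp at this
  | node _ a b iha ihb =>
    intro s h
    obtain ⟨a', b', hr, ha, hb⟩ := exists_rotation_to_root s _ _ _ h fun k hk => by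
      rw [length_rightSizes]; exact add_getElem_rightSizes_lt a k hk
    exact hr.trans ((TamariRotation.reflTransGen_left b' (iha a' ha)).trans
      (TamariRotation.reflTransGen_right a (ihb b' hb)))

/-- Right rotation orders binary trees by the sizes of their right subtrees. -/
theorem reflTransGen_tamariRotation_iff {s t : BinaryTree Unit} :
    Relation.ReflTransGen TamariRotation s t ↔
      List.Forall₂ (· ≤ ·) (rightSizes s) (rightSizes t) :=
  ⟨forall₂_rightSizes_of_reflTransGen, reflTransGen_of_forall₂_rightSizes t s⟩

end RightSizes

/-! ## Bracket vectors -/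

section BracketVectors

/-- Bracket vectors of length `n`: the entries `f i`, `i < n`, are the right ends of intervals
`[i, f i]` in `{0, …, n - 1}`, any two of which are disjoint or nested. -/
def IsBracketVector (n : ℕ) (f : ℕ → ℕ) : Prop :=
  ∀ i < n, i ≤ f i ∧ f i < n ∧ ∀ k, i < k → k ≤ f i → f k ≤ f i

/-- The bracket vector of a binary tree: its `i`-th entry is the position, in inorder, of the last
node in the right subtree of the `i`-th node (of the `i`-th node itself if that is empty). -/
def bracketVector (t : BinaryTree Unit) (i : ℕ) : ℕ :=
  i + (rightSizes t).getD i 0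

theorem bracketVector_node_of_lt (a b : BinaryTree Unit) {i : ℕ} (hi : i < a.numNodes) :
    bracketVector (.node () a b) i = bracketVector a i := by
  simp only [bracketVector, rightSizes]
  rw [List.getD_append _ _ _ _ (by rwa [length_rightSizes])]

theorem bracketVector_node_self (a b : BinaryTree Unit) :
    bracketVector (.node () a b) a.numNodes = a.numNodes + b.numNodes := by
  simp only [bracketVector, rightSizes]
  rw [List.getD_append_right _ _ _ _ (by rw [length_rightSizes]), length_rightSizes]
  simp

theorem bracketVector_node_add (a b : BinaryTree Unit) (i : ℕ) :
    bracketVector (.node () a b) (a.numNodes + 1 + i) = a.numNodes + 1 + bracketVector b i := by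
  simp only [bracketVector, rightSizes]
  rw [List.getD_append_right _ _ _ _ (by rw [length_rightSizes]; omega), length_rightSizes]
  have : a.numNodes + 1 + i - a.numNodes = i + 1 := by omega
  rw [this, List.getD_cons_succ]
  omega

theorem isBracketVector_bracketVector (t : BinaryTree Unit) :
    IsBracketVector t.numNodes (bracketVector t) := by
  induction t with
  | nil => exact fun i hi => by simp at hi
  | node _ a b iha ihb =>
    intro i hi
    simp only [BinaryTree.numNodes] at hi ⊢
    rcases lt_trichotomy i a.numNodes with h | rfl | h
    · obtain ⟨h₁, h₂, h₃⟩ := iha i h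
      rw [bracketVector_node_of_lt a b h]
      refine ⟨h₁, by omega, fun k hk hk' => ?_⟩
      rw [bracketVector_node_of_lt a b (by omega)]
      exact h₃ k hk hk'
    · rw [bracketVector_node_self]
      refine ⟨by omega, by omega, fun k hk hk' => ?_⟩
      obtain ⟨m, rfl⟩ := Nat.exists_eq_add_of_le (Nat.succ_le_of_lt hk)
      rw [Nat.succ_eq_add_one, bracketVector_node_add]
      have := (ihb m (by omega)).2.1
      omega
    · obtain ⟨m, rfl⟩ := Nat.exists_eq_add_of_le (Nat.succ_le_of_lt h)
      obtain ⟨h₁, h₂, h₃⟩ := ihb m (by omega)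
      rw [Nat.succ_eq_add_one, bracketVector_node_add]
      refine ⟨by omega, by omega, fun k hk hk' => ?_⟩
      obtain ⟨l, rfl⟩ := Nat.exists_eq_add_of_le (show a.numNodes + 1 ≤ k by omega)
      rw [bracketVector_node_add]
      have := h₃ l (by omega) (by omega)
      omega

theorem exists_bracketVector_eq (n : ℕ) : ∀ f : ℕ → ℕ, IsBracketVector n f →
    ∃ t : BinaryTree Unit, t.numNodes = n ∧ ∀ i < n, bracketVector t i = f i := by
  induction n using Nat.strong_induction_on with
  | _ n ih =>
  intro f hf
  rcases n with _ | m
  · exact ⟨.nil, rfl, fun i hi => by omega⟩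
  -- The root must be the first position whose bracket reaches the end.
  · have hex : ∃ k, k < m + 1 ∧ f k = m := ⟨m, by omega, by
      have := hf m (by omega)
      omega⟩
    classical
    obtain ⟨hkm, hk⟩ := Nat.find_spec hex
    have hmin := fun i => @Nat.find_min _ _ hex i
    generalize Nat.find hex = k at hkm hk hmin
    obtain ⟨a, ha, ha'⟩ := ih k hkm f fun i hi => by
      obtain ⟨h₁, h₂, h₃⟩ := hf i (by omega)
      refine ⟨h₁, ?_, h₃⟩
      -- A bracket from `i < k` reaching `k` would contain that of `k`, hence reach the end earlier
      -- than `k`.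
      by_contra h
      have := h₃ k hi (by omega)
      exact hmin i hi ⟨by omega, by omega⟩
    obtain ⟨b, hb, hb'⟩ := ih (m - k) (by omega) (fun i => f (k + 1 + i) - (k + 1)) fun i hi => by
      obtain ⟨h₁, h₂, h₃⟩ := hf (k + 1 + i) (by omega)
      dsimp only
      refine ⟨by omega, by omega, fun l hl hl' => ?_⟩
      have := h₃ (k + 1 + l) (by omega) (by omega)
      omega
    refine ⟨.node () a b, by simp only [BinaryTree.numNodes]; omega, fun i hi => ?_⟩
    rcases lt_trichotomy i k with h | rfl | h
    · rw [bracketVector_node_of_lt a b (by omega), ha' i h]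
    · subst ha
      rw [bracketVector_node_self]
      omega
    · obtain ⟨l, rfl⟩ := Nat.exists_eq_add_of_le (Nat.succ_le_of_lt h)
      subst ha
      rw [Nat.succ_eq_add_one, bracketVector_node_add, hb' l (by omega)]
      have := (hf (a.numNodes + 1 + l) (by omega)).1
      omega

theorem Tamari.le_iff_bracketVector_le {n : ℕ} {s t : Tamari n} :
    s ≤ t ↔ ∀ i < n, bracketVector s.1 i ≤ bracketVector t.1 i := by
  change Relation.ReflTransGen TamariRotation s.1 t.1 ↔ _
  have hs : (rightSizes s.1).length = n := (length_rightSizes _).trans s.2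
  have ht : (rightSizes t.1).length = n := (length_rightSizes _).trans t.2
  rw [reflTransGen_tamariRotation_iff, List.forall₂_iff_get]
  constructor
  · rintro ⟨-, h⟩ i hi
    have := h i (by omega) (by omega)
    simp only [bracketVector]
    rw [List.getD_eq_getElem _ _ (by omega), List.getD_eq_getElem _ _ (by omega)]
    exact Nat.add_le_add_left this i
  · refine fun h => ⟨hs.trans ht.symm, fun i hi hi' => ?_⟩
    have := h i (by omega)
    simp only [bracketVector] at this
    rw [List.getD_eq_getElem _ _ hi, List.getD_eq_getElem _ _ hi'] at this
    exact Nat.le_of_add_le_add_left this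

end BracketVectors

/-! ## Canonical join complexes of posets of bracket vectors -/

section BracketModel

/-- The partial order `L` is isomorphic, by means of `e`, to the set of all bracket vectors of
length `n` above `x`, ordered componentwise. -/
structure IsBracketModel {L : Type*} [PartialOrder L] (n : ℕ) (x : ℕ → ℕ) (e : L → ℕ → ℕ) :
    Prop where
  le_iff : ∀ a b : L, a ≤ b ↔ ∀ i < n, e a i ≤ e b i
  isBracketVector_base : IsBracketVector n x
  isBracketVector : ∀ a : L, IsBracketVector n (e a)
  base_le : ∀ a : L, ∀ i < n, x i ≤ e a i
  exists_eq : ∀ f : ℕ → ℕ, IsBracketVector n f → (∀ i < n, x i ≤ f i) →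
    ∃ a : L, ∀ i < n, e a i = f i

/-- The arcs over the bracket vector `x`. -/
def IsBracketArc (n : ℕ) (x : ℕ → ℕ) (p : ℕ × ℕ) : Prop :=
  p.1 < p.2 ∧ p.2 < n ∧ ∀ k, p.1 ≤ k → k < p.2 → x k < p.2

/-- The arcs of the bracket vector `f`, relative to `x`; they correspond to the coatoms of the
interval between `x` and `f`. -/
def IsDescentArc (n : ℕ) (x f : ℕ → ℕ) (p : ℕ × ℕ) : Prop :=
  p.1 < p.2 ∧ p.2 < n ∧ x p.1 < p.2 ∧ p.2 ≤ f p.1 ∧ f p.1 ≤ f p.2 ∧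
    ∀ k, p.1 < k → k < p.2 → f k < p.2

/-- The entries of the smallest bracket vector `f ≥ x` with `p.2 ≤ f p.1`. -/
def arcVector (x : ℕ → ℕ) (p : ℕ × ℕ) (h : ℕ) : ℕ :=
  if h ≤ p.1 ∧ p.1 ≤ x h then max (x h) (x p.2) else x h

theorem IsJoinIrreducible.of_forall_lt {L : Type*} [PartialOrder L] {j c : L} (hc : c < j)
    (h : ∀ b < j, b ≤ c) : IsJoinIrreducible j := by
  refine ⟨c, ⟨hc, fun b hcb hbj => (h b hbj).not_gt hcb⟩, fun b hb => ?_⟩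
  rcases (h b hb.lt).lt_or_eq with h' | h'
  · exact absurd hc (hb.2 h')
  · exact h'

theorem IsCanonicalJoinRepresentation.unique {L : Type*} [PartialOrder L]
    {A B : Finset L} {a : L}
    (hA : IsCanonicalJoinRepresentation A a) (hB : IsCanonicalJoinRepresentation B a) :
    A = B := by
  have key : ∀ A B : Finset L, IsCanonicalJoinRepresentation A a →
      IsCanonicalJoinRepresentation B a → A ⊆ B := by
    intro A B hA hB u hu
    obtain ⟨v, hv, huv⟩ := hA.2.2 B hB.1 u hu
    obtain ⟨w, hw, hvw⟩ := hB.2.2 A hA.1 v hv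
    obtain rfl := hA.2.1.eq hu hw (huv.trans hvw)
    rwa [huv.antisymm hvw]
  exact (key A B hA hB).antisymm (key B A hB hA)

variable {n : ℕ} {x f : ℕ → ℕ}

/-! ### Arc vectors and the lowering of entries -/

theorem isBracketVector_arcVector (hx : IsBracketVector n x) {p : ℕ × ℕ}
    (hp : IsBracketArc n x p) : IsBracketVector n (arcVector x p) := by
  obtain ⟨i, j⟩ := p
  obtain ⟨hij, hj, hk⟩ := hp
  simp only at hij hj hk
  have hxj := hx j hj
  intro h hh
  have hxh := hx h hh
  simp only [arcVector]
  split_ifs with h₁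
  · refine ⟨by omega, by omega, fun k hk₁ hk₂ => ?_⟩
    have hxk := hx k (by omega)
    -- Past `x h`, the position `k` is right of `i`: before `j` the arc condition bounds `x k`,
    -- after `j` nesting in the bracket of `j` does.
    have key : x k ≤ max (x h) (x j) := by
      by_cases h₂ : k ≤ x h
      · have := hxh.2.2 k hk₁ h₂
        omega
      · rcases lt_trichotomy k j with h₃ | rfl | h₃
        · have := hk k (by omega) h₃
          omega
        · omega
        · have := hxj.2.2 k h₃ (by omega)
          omega
    split_ifs with h₂
    · omega
    · exact key
  · refine ⟨by omega, by omega, fun k hk₁ hk₂ => ?_⟩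
    have := hxh.2.2 k hk₁ hk₂
    rw [if_neg (by omega)]
    exact this

theorem IsBracketArc.arcVector_self {p : ℕ × ℕ} (hx : IsBracketVector n x)
    (hp : IsBracketArc n x p) : arcVector x p p.1 = x p.2 := by
  have h₁ := hp.2.2 p.1 le_rfl hp.1
  have h₂ := hx p.1 (hp.1.trans hp.2.1)
  have h₃ := hx p.2 hp.2.1
  rw [arcVector, if_pos (by omega)]
  omega

theorem arcVector_of_lt {p : ℕ × ℕ} {k : ℕ} (h : p.1 < k) : arcVector x p k = x k :=
  if_neg (by omega)

theorem arcVector_le (hf : IsBracketVector n f)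
    (hxf : ∀ i < n, x i ≤ f i) {p : ℕ × ℕ} (hp : IsBracketArc n x p) (h : p.2 ≤ f p.1) :
    ∀ k < n, arcVector x p k ≤ f k := by
  intro k hk
  have h₁ := hxf k hk
  rw [arcVector]
  split_ifs with h₂
  · have h₃ := (hf p.1 (hp.1.trans hp.2.1)).2.2 p.2 hp.1 h
    have h₄ := hxf p.2 hp.2.1
    have h₅ : f p.1 ≤ f k := by
      rcases h₂.1.lt_or_eq with h₆ | h₆
      · exact (hf k hk).2.2 p.1 h₆ (h₂.2.trans h₁)
      · rw [h₆]
    omega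
  · exact h₁

/-- Lowering an entry of a bracket vector. -/
theorem IsBracketVector.update (hf : IsBracketVector n f) {i j : ℕ} (hij : i < j) (hj : j ≤ f i)
    (hk : ∀ k, i < k → k < j → f k < j) :
    IsBracketVector n (Function.update f i (j - 1)) := by
  intro h hh
  obtain ⟨h₁, h₂, h₃⟩ := hf h hh
  by_cases hi : h = i
  · subst hi
    rw [Function.update_self]
    refine ⟨by omega, by omega, fun k hk₁ hk₂ => ?_⟩
    rw [Function.update_of_ne (by omega)]
    have := hk k hk₁ (by omega)
    omega
  · rw [Function.update_of_ne hi]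
    refine ⟨h₁, h₂, fun k hk₁ hk₂ => ?_⟩
    have := h₃ k hk₁ hk₂
    by_cases hki : k = i
    · subst hki
      rw [Function.update_self]
      omega
    · rwa [Function.update_of_ne hki]

/-! ### Descent arcs and their compatibility -/

theorem IsDescentArc.isBracketArc {p : ℕ × ℕ} (hxf : ∀ i < n, x i ≤ f i)
    (hp : IsDescentArc n x f p) : IsBracketArc n x p := by
  obtain ⟨h₁, h₂, h₃, h₄, h₅, h₆⟩ := hp
  refine ⟨h₁, h₂, fun k hk hk' => ?_⟩
  rcases hk.lt_or_eq with h | h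
  · exact (hxf k (hk'.trans h₂)).trans_lt (h₆ k h hk')
  · rwa [← h]

/-- If `j < j'` were both right ends for `i`, then `f j < j' ≤ f i ≤ f j`. -/
theorem IsDescentArc.eq_of_fst_eq {p q : ℕ × ℕ} (hp : IsDescentArc n x f p)
    (hq : IsDescentArc n x f q) (h : p.1 = q.1) : p = q := by
  obtain ⟨h₁, h₂, h₃, h₄, h₅, h₆⟩ := hp
  obtain ⟨h₁', h₂', h₃', h₄', h₅', h₆'⟩ := hq
  refine Prod.ext h ?_
  rcases lt_trichotomy p.2 q.2 with h' | h' | h'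
  · have := h₆' p.2 (by omega) h'
    rw [h] at h₅
    omega
  · exact h'
  · have := h₆ q.2 (by omega) h'
    rw [h] at h₄
    omega

/-- If `q` starts strictly inside `p`, then `q.2 ≤ f q.1 < p.2`, so `q` is nested in `p` and ends
earlier. -/
theorem IsDescentArc.arcsCompatible {p q : ℕ × ℕ}
    (hp : IsDescentArc n x f p) (hq : IsDescentArc n x f q) (hpq : p ≠ q) :
    ArcsCompatible p q := by
  wlog h : p.1 < q.1 generalizing p q
  · rcases (not_lt.1 h).lt_or_eq with h' | h'
    · exact (this hq hp hpq.symm h').symm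
    · exact absurd (hq.eq_of_fst_eq hp h').symm hpq
  obtain ⟨h₁, h₂, h₃, h₄, h₅, h₆⟩ := hp
  obtain ⟨h₁', h₂', h₃', h₄', h₅', h₆'⟩ := hq
  refine ⟨h.ne, fun h' => ?_, fun h' => ?_, by omega⟩
  · have := h₆ q.1 h (by omega)
    omega
  · have := h₆ q.1 h h'.2.1
    omega

open Classical in
/-- The set of all arcs. -/
noncomputable def bracketArcs (n : ℕ) (x : ℕ → ℕ) : Finset (ℕ × ℕ) :=
  (Finset.range n ×ˢ Finset.range n).filter (IsBracketArc n x)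

theorem mem_bracketArcs {p : ℕ × ℕ} : p ∈ bracketArcs n x ↔ IsBracketArc n x p := by
  simp only [bracketArcs, Finset.mem_filter, Finset.mem_product, Finset.mem_range]
  exact ⟨fun h => h.2, fun h => ⟨⟨h.1.trans h.2.1, h.2.1⟩, h⟩⟩

open Classical in
/-- The arcs of an element of `L`. -/
noncomputable def descentArcs (n : ℕ) (x f : ℕ → ℕ) : Finset (ℕ × ℕ) :=
  (Finset.range n ×ˢ Finset.range n).filter (IsDescentArc n x f)

theorem mem_descentArcs {p : ℕ × ℕ} : p ∈ descentArcs n x f ↔ IsDescentArc n x f p := by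
  simp only [descentArcs, Finset.mem_filter, Finset.mem_product, Finset.mem_range]
  exact ⟨fun h => h.2, fun h => ⟨⟨h.1.trans h.2.1, h.2.1⟩, h⟩⟩

/-! ### Elements attached to arcs -/

namespace IsBracketModel

variable {L : Type*} [PartialOrder L] {e : L → ℕ → ℕ}

theorem exists_arc_element (M : IsBracketModel n x e) {p : ℕ × ℕ} (hp : IsBracketArc n x p) :
    ∃ a : L, ∀ i < n, e a i = arcVector x p i :=
  M.exists_eq _ (isBracketVector_arcVector M.isBracketVector_base hp) fun i _ => by
    rw [arcVector]
    split_ifs <;> omega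

theorem exists_update (M : IsBracketModel n x e) (a : L) {i j : ℕ} (hij : i < j)
    (hx : x i < j) (hj : j ≤ e a i) (hk : ∀ k, i < k → k < j → e a k < j) :
    ∃ b : L, ∀ k < n, e b k = Function.update (e a) i (j - 1) k := by
  refine M.exists_eq _ ((M.isBracketVector a).update hij hj hk) fun k hkn => ?_
  by_cases h : k = i
  · subst h
    rw [Function.update_self]
    omega
  · rw [Function.update_of_ne h]
    exact M.base_le a k hkn

theorem exists_top (M : IsBracketModel n x e) : ∃ a : L, ∀ i < n, e a i = n - 1 :=
  M.exists_eq (fun _ => n - 1) (fun i hi => ⟨Nat.le_sub_one_of_lt hi, Nat.sub_one_lt_of_lt hi, fun _ _ _ => le_rfl⟩)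
    fun i hi => by have := (M.isBracketVector_base i hi).2.1; omega

open Classical in
/-- The least element `a` with `p.2 ≤ e a p.1`. -/
noncomputable def arcElement (M : IsBracketModel n x e) (p : ℕ × ℕ) : L :=
  if hp : IsBracketArc n x p then (M.exists_arc_element hp).choose else M.exists_top.choose

theorem apply_arcElement (M : IsBracketModel n x e) {p : ℕ × ℕ} (hp : IsBracketArc n x p) :
    ∀ i < n, e (M.arcElement p) i = arcVector x p i := by
  rw [arcElement, dif_pos hp]
  exact (M.exists_arc_element hp).choose_spec

theorem arcElement_le_iff (M : IsBracketModel n x e) {p : ℕ × ℕ} (hp : IsBracketArc n x p)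
    (a : L) : M.arcElement p ≤ a ↔ p.2 ≤ e a p.1 := by
  rw [M.le_iff]
  constructor
  · intro h
    have h₁ := h p.1 (hp.1.trans hp.2.1)
    rw [M.apply_arcElement hp _ (hp.1.trans hp.2.1),
      hp.arcVector_self M.isBracketVector_base] at h₁
    exact (M.isBracketVector_base p.2 hp.2.1).1.trans h₁
  · intro h i hi
    rw [M.apply_arcElement hp i hi]
    exact arcVector_le (M.isBracketVector a) (M.base_le a) hp h i hi

/-- The left end is the last position where the vector exceeds `x`. Its entry there is `x p.2`,
which determines `p.2` because no bracket of `x` starting inside an arc reaches the right end. -/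
theorem injOn_arcElement (M : IsBracketModel n x e) :
    Set.InjOn M.arcElement {p | IsBracketArc n x p} := by
  have key : ∀ p q, IsBracketArc n x p → IsBracketArc n x q → M.arcElement p = M.arcElement q →
      p.1 ≤ q.1 ∧ (p.1 = q.1 → p.2 ≤ q.2) := by
    intro p q hp hq h
    have h₁ := (M.arcElement_le_iff hp _).1 h.le
    rw [M.apply_arcElement hq _ (hp.1.trans hp.2.1)] at h₁
    have h₂ := hp.2.2 p.1 le_rfl hp.1
    refine ⟨?_, fun h₃ => ?_⟩
    · by_contra h₃
      rw [arcVector_of_lt (by omega)] at h₁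
      omega
    · rw [h₃, hq.arcVector_self M.isBracketVector_base] at h₁
      by_contra h₄
      have := hp.2.2 q.2 (by have := hq.1; omega) (by omega)
      omega
  intro p hp q hq h
  have h₁ := key p q hp hq h
  have h₂ := key q p hq hp h.symm
  exact Prod.ext (by omega) (by omega)

/-- Lowering the entry at `p.1` to `p.2 - 1` gives the greatest element strictly below. -/
theorem isJoinIrreducible_arcElement (M : IsBracketModel n x e) {p : ℕ × ℕ}
    (hp : IsBracketArc n x p) : IsJoinIrreducible (M.arcElement p) := by
  have hpn := hp.1.trans hp.2.1
  obtain ⟨c, hc⟩ := M.exists_update (M.arcElement p) hp.1 (hp.2.2 p.1 le_rfl hp.1)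
    ((M.arcElement_le_iff hp _).1 le_rfl) fun k hk hk' => by
      rw [M.apply_arcElement hp k (hk'.trans hp.2.1), arcVector_of_lt hk]
      exact hp.2.2 k hk.le hk'
  have hcp := hc p.1 hpn
  rw [Function.update_self] at hcp
  have hp₁ := hp.1
  refine .of_forall_lt (c := c) (lt_of_le_not_ge ?_ ?_) fun b hb => ?_
  · rw [M.le_iff]
    intro k hk
    rw [hc k hk]
    by_cases h : k = p.1
    · subst h
      have := (M.arcElement_le_iff hp _).1 le_rfl
      rw [Function.update_self]
      omega
    · rw [Function.update_of_ne h]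
  · rw [M.arcElement_le_iff hp]
    omega
  · have h₁ := mt (M.arcElement_le_iff hp b).2 hb.not_ge
    rw [M.le_iff]
    intro k hk
    rw [hc k hk]
    by_cases h : k = p.1
    · subst h
      rw [Function.update_self]
      omega
    · rw [Function.update_of_ne h]
      exact (M.le_iff _ _).1 hb.le k hk

/-! ### Canonical join representations from descent arcs -/

theorem exists_lowering (M : IsBracketModel n x e) {a : L} {p : ℕ × ℕ}
    (hp : IsDescentArc n x (e a) p) :
    ∃ b : L, e b p.1 + 1 = p.2 ∧ ∀ k < n, k ≠ p.1 → e b k = e a k := by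
  obtain ⟨h₁, h₂, h₃, h₄, h₅, h₆⟩ := hp
  obtain ⟨b, hb⟩ := M.exists_update a h₁ h₃ h₄ h₆
  refine ⟨b, ?_, fun k hk hkp => ?_⟩
  · rw [hb _ (h₁.trans h₂), Function.update_self]
    omega
  · rw [hb k hk, Function.update_of_ne hkp]

/-- Downward induction on `i`: let `j > i` be the first position with `e a i ≤ e a j`. Either `j ≤ x
i` or `(i, j)` is a descent arc, so `j ≤ e b i`, and nesting in `b` gives `e a i ≤ e a j ≤ e b j ≤ e
b i`. -/
theorem le_of_forall_descentArc (M : IsBracketModel n x e) {a b : L}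
    (h : ∀ p, IsDescentArc n x (e a) p → p.2 ≤ e b p.1) : a ≤ b := by
  rw [M.le_iff]
  intro i hi
  induction hm : n - i using Nat.strong_induction_on generalizing i with
  | _ m ih =>
  obtain ⟨ha₁, ha₂, ha₃⟩ := M.isBracketVector a i hi
  have hxb := M.base_le b i hi
  have hxi := M.isBracketVector_base i hi
  by_cases hxa : e a i ≤ x i
  · exact hxa.trans hxb
  · have hex : ∃ j, i < j ∧ j ≤ e a i ∧ e a i ≤ e a j :=
      ⟨e a i, by omega, le_rfl, (M.isBracketVector a _ ha₂).1⟩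
    obtain ⟨hj₁, hj₂, hj₃⟩ := Nat.find_spec hex
    have hmin := fun k => @Nat.find_min _ _ hex k
    generalize Nat.find hex = j at hj₁ hj₂ hj₃ hmin
    have hjn : j < n := by omega
    have hj := ih (n - j) (by omega) j hjn rfl
    have hjb : j ≤ e b i := by
      by_cases hjx : j ≤ x i
      · exact hjx.trans hxb
      · refine h (i, j) ⟨hj₁, hjn, by simpa using hjx, hj₂, hj₃, fun k hk₁ hk₂ => ?_⟩
        simp only at hk₁ hk₂ ⊢
        by_contra hk₃
        have h₁ := (M.isBracketVector a k (by omega)).2.2 j hk₂ (by omega)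
        exact hmin k hk₂ ⟨hk₁, by omega, by omega⟩
    exact hj₃.trans (hj.trans ((M.isBracketVector b i hi).2.2 j hj₁ hjb))

open Classical in
theorem isCanonicalJoinRepresentation_image (M : IsBracketModel n x e) (a : L) :
    IsCanonicalJoinRepresentation ((descentArcs n x (e a)).image M.arcElement) a := by
  have harc : ∀ p, IsDescentArc n x (e a) p → IsBracketArc n x p := fun p hp =>
    hp.isBracketArc (M.base_le a)
  refine ⟨⟨?_, ?_, ?_⟩, ?_, ?_⟩
  · intro j hj
    obtain ⟨p, hp, rfl⟩ := Finset.mem_image.1 hj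
    exact M.isJoinIrreducible_arcElement (harc p (mem_descentArcs.1 hp))
  · rintro j hj
    obtain ⟨p, hp, rfl⟩ := Finset.mem_image.1 hj
    rw [mem_descentArcs] at hp
    exact (M.arcElement_le_iff (harc p hp) a).2 hp.2.2.2.1
  · intro b hb
    refine M.le_of_forall_descentArc fun p hp => ?_
    exact (M.arcElement_le_iff (harc p hp) b).1
      (hb (Finset.mem_image_of_mem _ (mem_descentArcs.2 hp)))
  · rintro j hj k hk hjk hle
    obtain ⟨p, hp, rfl⟩ := Finset.mem_image.1 hj
    obtain ⟨q, hq, rfl⟩ := Finset.mem_image.1 hk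
    rw [mem_descentArcs] at hp hq
    -- Lowering `a` at `p` leaves it above every other arc element but not above that of `p`.
    obtain ⟨b, hb₁, hb₂⟩ := M.exists_lowering hp
    have hqp : q.1 ≠ p.1 := fun h => hjk (by rw [hq.eq_of_fst_eq hp h])
    have hqb : M.arcElement q ≤ b := by
      rw [M.arcElement_le_iff (harc q hq), hb₂ _ (hq.1.trans hq.2.1) hqp]
      exact hq.2.2.2.1
    have := (M.arcElement_le_iff (harc p hp) b).1 (hle.trans hqb)
    omega
  · intro B hB j hj
    obtain ⟨p, hp, rfl⟩ := Finset.mem_image.1 hj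
    rw [mem_descentArcs] at hp
    -- Some `b ∈ B` is not below the lowering `c`. As `b ≤ a` and `c` differs from `a` only at
    -- `p.1`, the entry of `b` there is at least `p.2`.
    obtain ⟨c, hc₁, hc₂⟩ := M.exists_lowering hp
    have hac : ¬ a ≤ c := fun h => by
      have h₁ := (M.le_iff _ _).1 h p.1 (hp.1.trans hp.2.1)
      have h₂ := hp.2.2.2.1
      omega
    obtain ⟨b, hb, hbc⟩ : ∃ b ∈ B, ¬ b ≤ c := by
      by_contra h
      push Not at h
      exact hac (hB.2.2 h)
    refine ⟨b, hb, (M.arcElement_le_iff (harc p hp) b).2 ?_⟩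
    by_contra h
    refine hbc ((M.le_iff _ _).2 fun k hk => ?_)
    have hba := (M.le_iff _ _).1 (hB.2.1 hb) k hk
    by_cases hkp : k = p.1
    · subst hkp
      omega
    · rwa [hc₂ k hk hkp]

/-- Every set of pairwise compatible arcs is the set of arcs of an element. -/
theorem exists_descentArcs_eq (M : IsBracketModel n x e) {S : Finset (ℕ × ℕ)}
    (hS : S ⊆ bracketArcs n x) (hc : (S : Set (ℕ × ℕ)).Pairwise ArcsCompatible) :
    ∃ a : L, descentArcs n x (e a) = S := by
  let T : Set L := {a | ∀ p ∈ S, p.2 ≤ e a p.1}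
  have hSn : ∀ p ∈ S, IsBracketArc n x p := fun p hp => mem_bracketArcs.1 (hS hp)
  obtain ⟨t, ht⟩ := M.exists_top
  have hT : T.Nonempty := ⟨t, fun p hp => by
    have h₁ := (hSn p hp).1
    have h₂ := (hSn p hp).2.1
    rw [ht _ (h₁.trans h₂)]
    omega⟩
  -- Entrywise minima of bracket vectors are bracket vectors, so `T` has a least element `a`.
  have hmin : ∀ i, ∃ a ∈ T, ∀ b ∈ T, e a i ≤ e b i := fun i => by
    obtain ⟨a, ha, h⟩ := exists_minimalFor_of_wellFoundedLT (· ∈ T) (fun a => e a i) hT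
    exact ⟨a, ha, fun b hb => (le_total (e a i) (e b i)).elim id fun h' => h hb h'⟩
  choose m hmT hm using hmin
  obtain ⟨a, ha⟩ := M.exists_eq (fun i => e (m i) i)
    (fun i hi => by
      obtain ⟨h₁, h₂, h₃⟩ := M.isBracketVector (m i) i hi
      exact ⟨h₁, h₂, fun k hk hk' => (hm k _ (hmT i)).trans (h₃ k hk hk')⟩)
    fun i hi => M.base_le (m i) i hi
  have haT : a ∈ T := fun p hp => by
    rw [ha _ ((hSn p hp).1.trans (hSn p hp).2.1)]
    exact hmT _ p hp
  have hleast : ∀ f : ℕ → ℕ, IsBracketVector n f → (∀ i < n, x i ≤ f i) →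
      (∀ p ∈ S, p.2 ≤ f p.1) → ∀ i < n, e a i ≤ f i := by
    intro f hf hxf hSf i hi
    obtain ⟨b, hb⟩ := M.exists_eq f hf hxf
    rw [ha i hi, ← hb i hi]
    refine hm i b fun p hp => ?_
    rw [hb _ ((hSn p hp).1.trans (hSn p hp).2.1)]
    exact hSf p hp
  have hSa : ∀ p ∈ S, IsDescentArc n x (e a) p := by
    rintro ⟨i, j⟩ hp
    obtain ⟨hij, hjn, hxk⟩ := hSn _ hp
    have hcomp : ∀ q ∈ S, i < q.1 → q.1 < j → q.2 < j := fun q hq h₁ h₂ => by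
      have h := hc hp hq (by rintro rfl; exact h₁.ne rfl)
      obtain ⟨-, h₃, h₄, -⟩ := h
      simp only at h₃ h₄
      omega
    have haj := haT _ hp
    simp only at hij hjn hxk haj
    have hba := M.isBracketVector a
    refine ⟨hij, hjn, hxk i le_rfl hij, haj, ?_, fun k hk hkj => ?_⟩
    -- Capping the entries of `a` on `[i, j]` at `e a j` stays in `T`, so minimality gives `e a i ≤
    -- e a j`.
    · have := hleast (fun h => if i ≤ h ∧ h ≤ j then min (e a h) (e a j) else e a h) ?_ ?_ ?_ i
        (hij.trans hjn)
      · simp only [le_refl, hij.le, and_self, if_true] at this ⊢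
        omega
      · intro h hh
        obtain ⟨h₁, h₂, h₃⟩ := hba h hh
        have haj' := hba j hjn
        dsimp only
        split_ifs with h₄
        · refine ⟨by omega, by omega, fun k hk hk' => ?_⟩
          have h₅ := h₃ k hk (by omega)
          split_ifs with h₆
          · omega
          · have := haj'.2.2 k (by omega) (by omega)
            omega
        · refine ⟨h₁, h₂, fun k hk hk' => ?_⟩
          have h₅ := h₃ k hk hk'
          split_ifs <;> omega
      · intro h hh
        have h₁ := M.base_le a h hh
        have haj' := hba j hjn
        split_ifs with h₂
        · have h₃ := hxk h h₂.1
          rcases h₂.2.lt_or_eq with h₄ | rfl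
          · have := h₃ h₄
            omega
          · omega
        · exact h₁
      · intro q hq
        have h₁ := haT q hq
        have haj' := hba j hjn
        split_ifs with h₂
        · by_cases hqj : q.1 = j
          · rw [hqj] at h₁ ⊢
            omega
          · by_cases hqi : i = q.1
            · by_cases hqp : q = (i, j)
              · rw [hqp]; simp only; omega
              · exact absurd hqi (hc hp hq (Ne.symm hqp)).1
            · have := hcomp q hq (by omega) (by omega)
              omega
        · exact h₁
    · simp only at hk hkj ⊢
      -- Arcs of `S` starting strictly inside `(i, j)` end before `j`, so `j - 1` suffices there;
      -- elsewhere the maximal entry is harmless.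
      have := hleast (fun h => if i < h ∧ h < j then j - 1 else n - 1) ?_ ?_ ?_ k
        (hkj.trans hjn)
      · simp only [hk, hkj, and_self, if_true] at this
        omega
      · intro h hh
        dsimp only
        split_ifs with h₁
        · refine ⟨by omega, by omega, fun k hk hk' => ?_⟩
          rw [if_pos (by omega)]
        · refine ⟨by omega, by omega, fun k hk hk' => ?_⟩
          split_ifs <;> omega
      · intro h hh
        split_ifs with h₁
        · have := hxk h h₁.1.le h₁.2
          omega
        · have := (M.isBracketVector_base h hh).2.1
          omega
      · intro q hq
        split_ifs with h₁
        · have := hcomp q hq h₁.1 h₁.2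
          omega
        · have := (hSn q hq).2.1
          omega
  refine ⟨a, Finset.Subset.antisymm (fun p hp => ?_) fun p hp => mem_descentArcs.2 (hSa p hp)⟩
  rw [mem_descentArcs] at hp
  -- Lowering `a` at a descent `p` leaves `T`, so some arc of `S` starts at `p.1`; being a descent
  -- of `a` too, it equals `p`.
  obtain ⟨b, hb₁, hb₂⟩ := M.exists_lowering hp
  have hbT : b ∉ T := fun hb => by
    have h₁ := hleast (e b) (M.isBracketVector b) (M.base_le b) hb p.1 (hp.1.trans hp.2.1)
    have h₂ := hp.2.2.2.1
    omega
  simp only [T, Set.mem_ofPred_eq, not_forall] at hbT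
  obtain ⟨q, hq, hqb⟩ := hbT
  have hqp : q.1 = p.1 := by
    by_contra h
    rw [hb₂ _ ((hSn q hq).1.trans (hSn q hq).2.1) h] at hqb
    exact hqb (haT q hq)
  rwa [hp.eq_of_fst_eq (hSa q hq) hqp.symm]

-- The vertices are elements of `L`, so their arcs are read off by an inverse of `arcElement`.
open Classical in
theorem canonicalJoinComplex_eq (M : IsBracketModel n x e) :
    canonicalJoinComplex L =
      noncrossingComplex (Function.invFunOn M.arcElement {p | IsBracketArc n x p})
        ((bracketArcs n x).image M.arcElement) := by
  have hinv : ∀ p, IsBracketArc n x p →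
      Function.invFunOn M.arcElement {p | IsBracketArc n x p} (M.arcElement p) = p :=
    fun p hp => M.injOn_arcElement.leftInvOn_invFunOn hp
  ext A
  constructor
  · rintro ⟨a, hA⟩
    rw [hA.unique (M.isCanonicalJoinRepresentation_image a)]
    have harc : ∀ p ∈ descentArcs n x (e a), IsBracketArc n x p := fun p hp =>
      (mem_descentArcs.1 hp).isBracketArc (M.base_le a)
    refine ⟨Finset.image_subset_image fun p hp => mem_bracketArcs.2 (harc p hp), ?_⟩
    intro u hu v hv huv
    obtain ⟨p, hp, rfl⟩ := Finset.mem_image.1 hu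
    obtain ⟨q, hq, rfl⟩ := Finset.mem_image.1 hv
    rw [hinv p (harc p hp), hinv q (harc q hq)]
    exact (mem_descentArcs.1 hp).arcsCompatible (mem_descentArcs.1 hq)
      (by rintro rfl; exact huv rfl)
  · rintro ⟨hA, hc⟩
    obtain ⟨S, hS, rfl⟩ := Finset.subset_image_iff.1 hA
    have hS' : S ⊆ bracketArcs n x := hS
    have harc : ∀ p ∈ S, IsBracketArc n x p := fun p hp => mem_bracketArcs.1 (hS' hp)
    obtain ⟨a, ha⟩ := M.exists_descentArcs_eq hS' fun p hp q hq hpq => by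
      have := hc (Finset.mem_coe.2 (Finset.mem_image_of_mem M.arcElement hp))
        (Finset.mem_coe.2 (Finset.mem_image_of_mem M.arcElement hq))
        fun h => hpq (M.injOn_arcElement (harc p hp) (harc q hq) h)
      simp only [hinv p (harc p hp), hinv q (harc q hq)] at this
      exact this
    refine ⟨a, ?_⟩
    rw [← ha]
    exact M.isCanonicalJoinRepresentation_image a

theorem isSimplicialComplex_canonicalJoinComplex (M : IsBracketModel n x e) :
    IsSimplicialComplex (canonicalJoinComplex L) := by
  rw [M.canonicalJoinComplex_eq]
  exact isSimplicialComplex_noncrossingComplex _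

theorem vertexDecomposable_canonicalJoinComplex (M : IsBracketModel n x e) :
    VertexDecomposable (canonicalJoinComplex L) := by
  classical
  have hinv : ∀ p, IsBracketArc n x p →
      Function.invFunOn M.arcElement {p | IsBracketArc n x p} (M.arcElement p) = p :=
    fun p hp => M.injOn_arcElement.leftInvOn_invFunOn hp
  rw [M.canonicalJoinComplex_eq]
  refine vertexDecomposable_noncrossingComplex _ ?_ ?_ ?_
  · intro u hu v hv h
    obtain ⟨p, hp, rfl⟩ := Finset.mem_image.1 hu
    obtain ⟨q, hq, rfl⟩ := Finset.mem_image.1 hv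
    rw [hinv p (mem_bracketArcs.1 hp), hinv q (mem_bracketArcs.1 hq)] at h
    rw [h]
  · intro u hu
    obtain ⟨p, hp, rfl⟩ := Finset.mem_image.1 hu
    rw [hinv p (mem_bracketArcs.1 hp)]
    exact (mem_bracketArcs.1 hp).1
  · intro u hu k hk₁ hk₂
    obtain ⟨p, hp, rfl⟩ := Finset.mem_image.1 hu
    rw [mem_bracketArcs] at hp
    rw [hinv p hp] at hk₁ hk₂ ⊢
    -- The arc condition concerns starting points in `[p.1, p.2)`, so it survives moving the left
    -- end to the right.
    have hk : IsBracketArc n x (k, p.2) :=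
      ⟨hk₂, hp.2.1, fun l hl hl' => hp.2.2 l (hk₁.le.trans hl) hl'⟩
    exact ⟨M.arcElement (k, p.2), Finset.mem_image_of_mem _ (mem_bracketArcs.2 hk), hinv _ hk⟩

end IsBracketModel

theorem Tamari.isBracketModel_Icc {n : ℕ} (x : Tamari n) :
    IsBracketModel (L := Set.Icc x ⊤) n (bracketVector x.1) fun a => bracketVector a.1.1 where
  le_iff a b := Tamari.le_iff_bracketVector_le
  isBracketVector_base := by
    have := isBracketVector_bracketVector x.1
    rwa [x.2] at this
  isBracketVector a := by
    have := isBracketVector_bracketVector a.1.1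
    rwa [a.1.2] at this
  base_le a := Tamari.le_iff_bracketVector_le.1 a.2.1
  exists_eq f hf hxf := by
    obtain ⟨t, ht, h⟩ := exists_bracketVector_eq n f hf
    refine ⟨⟨⟨t, ht⟩, Tamari.le_iff_bracketVector_le.2 fun i hi => ?_, le_top⟩, h⟩
    exact (hxf i hi).trans (h i hi).ge

end BracketModel

theorem mainTheorem9 (n : ℕ) (I : Set (Tamari n)) (hI : IsRightInterval I) :
    IsSimplicialComplex (canonicalJoinComplex I) ∧
      VertexDecomposable (canonicalJoinComplex I) ∧
      Shellable (canonicalJoinComplex I) := by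
  obtain ⟨x, rfl⟩ := hI
  have M := x.isBracketModel_Icc
  exact ⟨M.isSimplicialComplex_canonicalJoinComplex, M.vertexDecomposable_canonicalJoinComplex,
    M.vertexDecomposable_canonicalJoinComplex.shellable
      M.isSimplicialComplex_canonicalJoinComplex⟩
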